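/- A Banach space over $\mathbb{R}$ is said to have the Daugavet property if $\|I+T\| = 1+\|T\|$ for every bounded linear operator $T$ of rank one from the space to itself, where $I$ is the identity operator. A subspace $X$ of a real Banach space $Y$ is called an almost isometric ideal (ai-ideal) in $Y$ if for every $\varepsilon>0$ and every finite-dimensional subspace $E$ of $Y$ there exists a linear operator $T:E\to X$ such that $Te=e$ for all $e\in E\cap X$ and $(1-\varepsilon)\|e\|\le\|Te\|\le(1+\varepsilon)\|e\|$ for all $e\in E$. Let $Y$ be a real Banach space. Then $Y$ has the Daugavet property if and only if every closed separable subspace $X$ of $Y$ which is an ai-ideal in $Y$ has the Daugavet property. -/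

import Mathlib

/-- A real normed space `Y` has the Daugavet property if `‖I + T‖ = 1 + ‖T‖` for every bounded
linear operator `T : Y → Y` of rank one. -/
def DaugavetProperty (Y : Type*) [NormedAddCommGroup Y] [NormedSpace ℝ Y] : Prop :=
  ∀ T : Y →L[ℝ] Y, (T : Y →ₗ[ℝ] Y).rank = 1 →
    ‖ContinuousLinearMap.id ℝ Y + T‖ = 1 + ‖T‖

/-- A subspace `X` of `Y` is an almost isometric ideal if for every `ε > 0` and every
finite-dimensional subspace `E` of `Y` there is a linear operator `T : E → X` which fixes
`E ∩ X` pointwise and satisfies `(1 - ε)‖e‖ ≤ ‖T e‖ ≤ (1 + ε)‖e‖` on `E`. -/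
def IsAlmostIsometricIdeal {Y : Type*} [NormedAddCommGroup Y] [NormedSpace ℝ Y]
    (X : Submodule ℝ Y) : Prop :=
  ∀ ε : ℝ, 0 < ε → ∀ E : Submodule ℝ Y, FiniteDimensional ℝ E →
    ∃ T : E →ₗ[ℝ] X,
      (∀ e : E, (e : Y) ∈ X → (T e : Y) = (e : Y)) ∧
      ∀ e : E, (1 - ε) * ‖e‖ ≤ ‖T e‖ ∧ ‖T e‖ ≤ (1 + ε) * ‖e‖

/-!
Since rank-one operators have the form `φ ⊗ y : z ↦ φ z • y`, the Daugavet property says that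
`1 + ‖φ‖ * ‖y‖ ≤ ‖I + φ ⊗ y‖` for all functionals `φ` and vectors `y`.

It passes to an ai-ideal `X`: extend a functional `f` on `X` to `Y` as a weak* limit `F` of
Hahn–Banach extensions of `f ∘ T`, where `T` runs through almost isometric retractions of
finite-dimensional subspaces into `X`. On a given finite-dimensional subspace, `T` nearly
intertwines `I + F ⊗ x` with `I + f ⊗ x`, so that `‖I + F ⊗ x‖ ≤ ‖I + f ⊗ x‖`, while `‖f‖ ≤ ‖F‖`.

Conversely, a Löwenheim–Skolem argument embeds every separable set in a closed separable ai-ideal: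
the metric types of finite tuples over a separable set form a separable space, so they can be
approximately realized in a larger separable subspace, and one iterates. Given `φ` and `y`, choose
such an ideal containing `y` and a countable set norming `φ`; the Daugavet inequality for `y` and
the restriction of `φ` to the ideal yields the one for `y` and `φ`.
-/

open Filter Topology Set Metric Module TopologicalSpace

section RankOne

variable {K E F : Type*} [Field K] [TopologicalSpace K] [IsTopologicalRing K]
  [AddCommGroup E] [Module K E] [TopologicalSpace E]
  [AddCommGroup F] [Module K F] [TopologicalSpace F] [ContinuousSMul K F] [SeparatingDual K F]

theorem rank_eq_one_iff_exists_smulRight (T : E →L[K] F) :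
    (T : E →ₗ[K] F).rank = 1 ↔ ∃ φ : E →L[K] K, φ ≠ 0 ∧ ∃ y : F, y ≠ 0 ∧ φ.smulRight y = T := by
  constructor
  · intro hT
    obtain ⟨y, ⟨x, hx⟩, hy, hrange⟩ := (rank_submodule_eq_one_iff _).1 hT
    obtain ⟨g, hg⟩ := SeparatingDual.exists_eq_one (R := K) hy
    refine ⟨g.comp T, fun h => one_ne_zero (α := K) ?_, y, hy, ContinuousLinearMap.ext fun z => ?_⟩
    · calc (1 : K) = g (T x) := by rw [← hg, ← hx]; rfl
        _ = 0 := DFunLike.congr_fun h x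
    · obtain ⟨c, hc⟩ := Submodule.mem_span_singleton.1
        (hrange (LinearMap.mem_range_self (T : E →ₗ[K] F) z))
      rw [ContinuousLinearMap.coe_coe] at hc
      simp [← hc, hg]
  · rintro ⟨φ, hφ, y, hy, rfl⟩
    obtain ⟨z, hz⟩ := DFunLike.ne_iff.1 hφ
    refine (rank_submodule_eq_one_iff _).2 ⟨y, ⟨(φ z)⁻¹ • z, ?_⟩, hy, ?_⟩
    · have : φ z ≠ 0 := hz
      simp [this]
    · rintro _ ⟨x, rfl⟩
      exact Submodule.mem_span_singleton.2 ⟨φ x, rfl⟩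

end RankOne

section Daugavet

variable {Y : Type*} [NormedAddCommGroup Y] [NormedSpace ℝ Y]

theorem daugavetProperty_iff_smulRight :
    DaugavetProperty Y ↔ ∀ φ : Y →L[ℝ] ℝ, φ ≠ 0 → ∀ y : Y, y ≠ 0 →
      1 + ‖φ‖ * ‖y‖ ≤ ‖ContinuousLinearMap.id ℝ Y + φ.smulRight y‖ := by
  refine ⟨fun hY φ hφ y hy => ?_, fun h T hT => le_antisymm ?_ ?_⟩
  · rw [hY _ ((rank_eq_one_iff_exists_smulRight _).2 ⟨φ, hφ, y, hy, rfl⟩),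
      ContinuousLinearMap.norm_smulRight_apply]
  · exact (norm_add_le _ _).trans (by gcongr; exact ContinuousLinearMap.norm_id_le)
  · obtain ⟨φ, hφ, y, hy, rfl⟩ := (rank_eq_one_iff_exists_smulRight T).1 hT
    rw [ContinuousLinearMap.norm_smulRight_apply]
    exact h φ hφ y hy

theorem norm_id_add_smulRight_restrict_le (φ : Y →L[ℝ] ℝ) {X : Submodule ℝ Y} (x : X) :
    ‖ContinuousLinearMap.id ℝ X + (φ.comp X.subtypeL).smulRight x‖ ≤
      ‖ContinuousLinearMap.id ℝ Y + φ.smulRight (x : Y)‖ :=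
  ContinuousLinearMap.opNorm_le_bound _ (norm_nonneg _) fun z =>
    (ContinuousLinearMap.id ℝ Y + φ.smulRight (x : Y)).le_opNorm z

end Daugavet

theorem exists_tendsto_eval_of_norm_le {𝕜 V ι : Type*} [NontriviallyNormedField 𝕜] [ProperSpace 𝕜]
    [SeminormedAddCommGroup V] [NormedSpace 𝕜 V] (U : Ultrafilter ι) {G : ι → V →L[𝕜] 𝕜} {r : ℝ}
    (hG : ∀ i, ‖G i‖ ≤ r) :
    ∃ F : V →L[𝕜] 𝕜, ∀ v, Tendsto (fun i => G i v) U (𝓝 (F v)) := by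
  obtain ⟨F, -, hF⟩ := (WeakDual.isCompact_closedBall (0 : StrongDual 𝕜 V) r).ultrafilter_le_nhds'
    (U.map fun i => StrongDual.toWeakDual (G i))
    (Eventually.of_forall (f := (U : Filter ι)) fun i => mem_closedBall_zero_iff.2 (hG i))
  exact ⟨WeakDual.toStrongDual F, fun v => ((WeakDual.eval_continuous v).tendsto F).comp hF⟩

section Extension

/-- A linear map `T : E → X` between subspaces of `Y` which fixes `E ∩ X` pointwise and is an
`ε`-isometry; by definition, `X` is an almost isometric ideal when such maps exist for all `ε > 0`
and all finite-dimensional `E`. -/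
def IsAlmostIsometricRetraction {Y : Type*} [NormedAddCommGroup Y] [NormedSpace ℝ Y]
    {E X : Submodule ℝ Y} (ε : ℝ) (T : E →ₗ[ℝ] X) : Prop :=
  (∀ e : E, (e : Y) ∈ X → (T e : Y) = e) ∧
    ∀ e : E, (1 - ε) * ‖e‖ ≤ ‖T e‖ ∧ ‖T e‖ ≤ (1 + ε) * ‖e‖

variable {Y : Type*} [NormedAddCommGroup Y] [NormedSpace ℝ Y] {E X : Submodule ℝ Y}
  {ε : ℝ} {T : E →ₗ[ℝ] X}

namespace IsAlmostIsometricRetraction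

theorem restrict (hT : IsAlmostIsometricRetraction ε T) {E' : Submodule ℝ Y} (hE : E' ≤ E)
    {δ : ℝ} (hδ : ε ≤ δ) :
    IsAlmostIsometricRetraction δ (T.comp (Submodule.inclusion hE)) := by
  refine ⟨fun e he => hT.1 (Submodule.inclusion hE e) he, fun e => ?_⟩
  obtain ⟨hlower, hupper⟩ := hT.2 (Submodule.inclusion hE e)
  exact ⟨(mul_le_mul_of_nonneg_right (by linarith) (norm_nonneg e)).trans hlower,
    hupper.trans (mul_le_mul_of_nonneg_right (by linarith) (norm_nonneg e))⟩

theorem exists_extension_comp (hT : IsAlmostIsometricRetraction ε T) (hε : 0 ≤ ε)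
    (f : X →L[ℝ] ℝ) :
    ∃ G : Y →L[ℝ] ℝ, ‖G‖ ≤ (1 + ε) * ‖f‖ ∧ ∀ e : E, G e = f (T e) := by
  let fT : E →L[ℝ] ℝ := f.comp (T.mkContinuous (1 + ε) fun e => (hT.2 e).2)
  obtain ⟨G, hG, hnorm⟩ := exists_extension_norm_eq E fT
  refine ⟨G, ?_, hG⟩
  calc ‖G‖ = ‖fT‖ := hnorm
    _ ≤ ‖f‖ * (1 + ε) := (f.opNorm_comp_le _).trans
      (by gcongr; exact T.mkContinuous_norm_le (by positivity) _)
    _ = (1 + ε) * ‖f‖ := mul_comm _ _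

end IsAlmostIsometricRetraction

theorem IsAlmostIsometricIdeal.exists_extension (hX : IsAlmostIsometricIdeal X) (f : X →L[ℝ] ℝ) :
    ∃ F : Y →L[ℝ] ℝ, (∀ x : X, F x = f x) ∧
      ∀ (E : Submodule ℝ Y) [FiniteDimensional ℝ E] (y : E) {ε : ℝ}, 0 < ε →
        ∃ T : E →ₗ[ℝ] X, IsAlmostIsometricRetraction ε T ∧ |f (T y) - F y| < ε := by
  classical
  let span (i : Finset Y × ℕ) : Submodule ℝ Y := Submodule.span ℝ (i.1 : Set Y)
  let tol (i : Finset Y × ℕ) : ℝ := 1 / (i.2 + 1)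
  have tol_pos (i) : 0 < tol i := Nat.one_div_pos_of_nat
  have tol_le_one (i) : tol i ≤ 1 := by
    simpa [tol] using Nat.one_div_le_one_div (α := ℝ) (Nat.zero_le i.2)
  choose T hT using fun i => hX (tol i) (tol_pos i) (span i) (FiniteDimensional.span_finset ℝ i.1)
  choose G hGnorm hGT using fun i =>
    IsAlmostIsometricRetraction.exists_extension_comp (hT i) (tol_pos i).le f
  let U : Ultrafilter (Finset Y × ℕ) := Ultrafilter.of atTop
  have hU : (U : Filter (Finset Y × ℕ)) ≤ atTop := Ultrafilter.of_le atTop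
  have eventually_le_span (E : Submodule ℝ Y) [FiniteDimensional ℝ E] : ∀ᶠ i in U, E ≤ span i := by
    obtain ⟨s, rfl⟩ := (Submodule.fg_iff_finiteDimensional E).2 inferInstance
    exact hU ((eventually_ge_atTop (s, 0)).mono fun i hi => Submodule.span_mono hi.1)
  have eventually_tol_lt {ε : ℝ} (hε : 0 < ε) : ∀ᶠ i in U, tol i < ε := by
    obtain ⟨n, hn⟩ := exists_nat_one_div_lt hε
    exact hU ((eventually_ge_atTop (∅, n)).mono fun i hi =>
      (Nat.one_div_le_one_div hi.2).trans_lt hn)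
  obtain ⟨F, hF⟩ := exists_tendsto_eval_of_norm_le U (r := 2 * ‖f‖) fun i =>
    (hGnorm i).trans (by gcongr; linarith [tol_le_one i])
  refine ⟨F, fun x => tendsto_nhds_unique (hF x) (tendsto_const_nhds.congr' ?_),
    fun E _ y ε hε => ?_⟩
  · filter_upwards [eventually_le_span (ℝ ∙ (x : Y))] with i hi
    let e : span i := ⟨x, hi (Submodule.mem_span_singleton_self _)⟩
    have hTe : T i e = x := Subtype.ext ((hT i).1 e x.2)
    rw [← hTe, ← hGT i e, hTe]
  · obtain ⟨i, hE, htol, hlim⟩ := ((eventually_le_span E).and ((eventually_tol_lt hε).and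
      ((hF y).eventually (ball_mem_nhds _ hε)))).exists
    refine ⟨_, IsAlmostIsometricRetraction.restrict (hT i) hE htol.le, ?_⟩
    have := hGT i (Submodule.inclusion hE y)
    rw [LinearMap.comp_apply, ← this]
    exact hlim

theorem norm_id_add_smulRight_le_of_forall_retraction {F : Y →L[ℝ] ℝ} {f : X →L[ℝ] ℝ}
    (hF : ∀ (E : Submodule ℝ Y) [FiniteDimensional ℝ E] (y : E) {ε : ℝ}, 0 < ε →
      ∃ T : E →ₗ[ℝ] X, IsAlmostIsometricRetraction ε T ∧ |f (T y) - F y| < ε) (x : X) :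
    ‖ContinuousLinearMap.id ℝ Y + F.smulRight (x : Y)‖ ≤
      ‖ContinuousLinearMap.id ℝ X + f.smulRight x‖ := by
  set S := ContinuousLinearMap.id ℝ X + f.smulRight x
  refine ContinuousLinearMap.opNorm_le_bound _ (norm_nonneg S) fun y => ?_
  let E := Submodule.span ℝ {y, (x : Y)}
  let yE : E := ⟨y, Submodule.subset_span (by simp)⟩
  let xE : E := ⟨x, Submodule.subset_span (by simp)⟩
  have bound (ε : ℝ) (hε : 0 < ε) :
      (1 - ε) * ‖y + F y • (x : Y)‖ ≤ ‖S‖ * ((1 + ε) * ‖y‖) + ε * ‖x‖ := by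
    have : FiniteDimensional ℝ E := FiniteDimensional.span_of_finite ℝ (by simp)
    obtain ⟨T, hT, hf⟩ := hF E yE hε
    have hTx : T xE = x := Subtype.ext (hT.1 xE x.2)
    calc (1 - ε) * ‖y + F y • (x : Y)‖ ≤ ‖T (yE + F y • xE)‖ :=
        (hT.2 (yE + F y • xE)).1
      _ = ‖S (T yE) - (f (T yE) - F y) • x‖ := by
        rw [map_add, map_smul, hTx]
        congr 1
        simp only [S, add_apply, ContinuousLinearMap.id_apply,
          ContinuousLinearMap.smulRight_apply]
        module
      _ ≤ ‖S (T yE)‖ + ‖(f (T yE) - F y) • x‖ := norm_sub_le _ _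
      _ ≤ ‖S‖ * ((1 + ε) * ‖y‖) + ε * ‖x‖ := by
        rw [norm_smul, Real.norm_eq_abs]
        gcongr
        exact (S.le_opNorm _).trans (by gcongr; exact (hT.2 yE).2)
  have left_limit : Tendsto (fun ε : ℝ => (1 - ε) * ‖y + F y • (x : Y)‖) (𝓝[>] 0)
      (𝓝 ‖y + F y • (x : Y)‖) :=
    tendsto_nhdsWithin_of_tendsto_nhds (Continuous.tendsto' (by fun_prop) _ _ (by simp))
  have right_limit : Tendsto (fun ε : ℝ => ‖S‖ * ((1 + ε) * ‖y‖) + ε * ‖x‖) (𝓝[>] 0)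
      (𝓝 (‖S‖ * ‖y‖)) :=
    tendsto_nhdsWithin_of_tendsto_nhds (Continuous.tendsto' (by fun_prop) _ _ (by simp))
  exact le_of_tendsto_of_tendsto left_limit right_limit
    (eventually_mem_nhdsWithin.mono fun ε hε => bound ε hε)

theorem DaugavetProperty.of_isAlmostIsometricIdeal (hY : DaugavetProperty Y)
    (hX : IsAlmostIsometricIdeal X) : DaugavetProperty X := by
  rw [daugavetProperty_iff_smulRight] at hY ⊢
  intro f hf x hx
  obtain ⟨F, hFf, hF⟩ := hX.exists_extension f
  have hfF : f = F.comp X.subtypeL := ContinuousLinearMap.ext fun z => (hFf z).symm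
  have hF0 : F ≠ 0 := by
    rintro rfl
    exact hf (by simpa using hfF)
  have hnorm : ‖f‖ ≤ ‖F‖ :=
    f.opNorm_le_bound (norm_nonneg F) fun z => hFf z ▸ F.le_opNorm z
  calc 1 + ‖f‖ * ‖x‖ ≤ 1 + ‖F‖ * ‖(x : Y)‖ := by gcongr; rfl
    _ ≤ ‖ContinuousLinearMap.id ℝ Y + F.smulRight (x : Y)‖ :=
      hY F hF0 x (by simpa using hx)
    _ ≤ ‖ContinuousLinearMap.id ℝ X + f.smulRight x‖ :=
      norm_id_add_smulRight_le_of_forall_retraction hF x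

end Extension

theorem exists_countable_subset_image_subset_closure {α β : Type*} [TopologicalSpace β]
    [PseudoMetrizableSpace β] {f : α → β} {s : Set α} (hs : IsSeparable (f '' s)) :
    ∃ t ⊆ s, t.Countable ∧ f '' s ⊆ closure (f '' t) := by
  obtain ⟨d, hds, hd, hdense⟩ := hs.exists_countable_dense_subset
  obtain ⟨t, hts, htd⟩ := SurjOn.exists_bijOn_subset hds
  exact ⟨t, hts, countable_of_injective_of_countable_image htd.injOn (htd.image_eq ▸ hd),
    htd.image_eq ▸ hdense⟩

theorem exists_countable_forall_norm_comp_subtypeL_eq {𝕜 E F : Type*} [DenselyNormedField 𝕜]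
    [NormedAddCommGroup E] [NormedSpace 𝕜 E] [SeminormedAddCommGroup F] [NormedSpace 𝕜 F]
    (φ : E →L[𝕜] F) :
    ∃ s : Set E, s.Countable ∧ ∀ X : Submodule 𝕜 E, s ⊆ X → ‖φ.comp X.subtypeL‖ = ‖φ‖ := by
  obtain ⟨r, -, hr, hlim⟩ := exists_seq_strictMono_tendsto ‖φ‖
  choose x hx hφx using fun n => φ.exists_lt_apply_of_lt_opNorm (hr n)
  refine ⟨range x, countable_range x, fun X hX => le_antisymm ?_ (le_of_tendsto' hlim fun n => ?_)⟩
  · exact ContinuousLinearMap.opNorm_le_bound _ (norm_nonneg φ) fun z => φ.le_opNorm z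
  · let z : X := ⟨x n, hX (mem_range_self n)⟩
    exact (hφx n).le.trans (((φ.comp X.subtypeL).le_opNorm z).trans
      (mul_le_of_le_one_right (norm_nonneg _) (hx n).le))

theorem exists_basis_span_image_eq {K V : Type*} [DivisionRing K] [AddCommGroup V] [Module K V]
    [FiniteDimensional K V] (W : Submodule K V) :
    ∃ (n : ℕ) (b : Basis (Fin n) K V) (I : Set (Fin n)), Submodule.span K (b '' I) = W := by
  obtain ⟨s, -, hspan, (hs : LinearIndepOn K id s)⟩ := exists_linearIndependent K (W : Set V)
  let b := Basis.extend hs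
  have := FiniteDimensional.fintypeBasisIndex b
  let b' := b.reindex (Fintype.equivFin _)
  have hsb' : s ⊆ range b' := by
    rw [Basis.range_reindex, Basis.range_extend]
    exact Basis.subset_extend hs
  exact ⟨_, b', b' ⁻¹' s, by rw [image_preimage_eq_of_subset hsb', hspan, Submodule.span_eq]⟩

section NormType

variable {ι Y : Type*} [Fintype ι] [SeminormedAddCommGroup Y] [NormedSpace ℝ Y]

/-- The function `c ↦ ‖∑ i, c i • x i‖` recording the norms of all linear combinations of a finite
tuple `x`. By homogeneity it suffices to take coefficients in the unit ball, whose compactness makes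
the space of such functions a separable metric space. -/
def combinationNorm (x : ι → Y) : C(closedBall (0 : ι → ℝ) 1, ℝ) where
  toFun c := ‖∑ i, c.1 i • x i‖
  continuous_toFun := continuous_norm.comp <| continuous_finsetSum _ fun i _ =>
    ((continuous_apply i).comp continuous_subtype_val).smul continuous_const

theorem dist_combinationNorm_le (x y : ι → Y) :
    dist (combinationNorm x) (combinationNorm y) ≤ Fintype.card ι * dist x y := by
  refine (ContinuousMap.dist_le (by positivity)).2 fun c => ?_
  have norm_coeff_le (i : ι) : ‖c.1 i‖ ≤ 1 :=
    (norm_le_pi_norm c.1 i).trans (mem_closedBall_zero_iff.1 c.2)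
  calc |‖∑ i, c.1 i • x i‖ - ‖∑ i, c.1 i • y i‖|
      ≤ ‖∑ i, c.1 i • x i - ∑ i, c.1 i • y i‖ := abs_norm_sub_norm_le _ _
    _ = ‖∑ i, c.1 i • (x i - y i)‖ := by simp only [smul_sub, Finset.sum_sub_distrib]
    _ ≤ ∑ i, ‖c.1 i • (x i - y i)‖ := norm_sum_le _ _
    _ ≤ ∑ _i : ι, dist x y := Finset.sum_le_sum fun i _ => by
      rw [norm_smul, ← dist_eq_norm]
      exact (mul_le_of_le_one_left dist_nonneg (norm_coeff_le i)).trans (dist_le_pi_dist x y i)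
    _ = Fintype.card ι * dist x y := by simp

theorem continuous_combinationNorm :
    Continuous (combinationNorm : (ι → Y) → C(closedBall (0 : ι → ℝ) 1, ℝ)) :=
  (LipschitzWith.of_dist_le_mul (K := Fintype.card ι) dist_combinationNorm_le).continuous

theorem abs_norm_sum_smul_sub_le (x y : ι → Y) (c : ι → ℝ) :
    |‖∑ i, c i • x i‖ - ‖∑ i, c i • y i‖| ≤
      dist (combinationNorm x) (combinationNorm y) * ‖c‖ := by
  rcases eq_or_ne c 0 with rfl | hc
  · simp
  have hc' : ‖c‖ ≠ 0 := norm_ne_zero_iff.2 hc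
  let u : closedBall (0 : ι → ℝ) 1 := ⟨‖c‖⁻¹ • c, by simp [norm_smul, hc']⟩
  have rescale (z : ι → Y) : ‖∑ i, c i • z i‖ = ‖c‖ * combinationNorm z u := by
    have : ∑ i, c i • z i = ‖c‖ • ∑ i, u.1 i • z i := by
      simp [u, Finset.smul_sum, smul_smul, hc']
    rw [this, norm_smul, norm_norm]
    rfl
  rw [rescale x, rescale y, ← mul_sub, abs_mul, abs_norm, mul_comm]
  gcongr
  exact ContinuousMap.dist_apply_le_dist (f := combinationNorm x) (g := combinationNorm y) u

/-- The metric type of a tuple `x` over its entries indexed by `I`: these entries themselves,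
together with the norms of all linear combinations of `x`. -/
def normType (I : Set ι) (x : ι → Y) : (I → Y) × C(closedBall (0 : ι → ℝ) 1, ℝ) :=
  (I.domRestrict x, combinationNorm x)

theorem continuous_normType (I : Set ι) : Continuous (normType I : (ι → Y) → _) :=
  (Pi.continuous_domRestrict I).prodMk continuous_combinationNorm

theorem isSeparable_normType_image {I : Set ι} {S : Set Y} (hS : IsSeparable S) :
    IsSeparable (normType I '' I.pi fun _ => S) :=
  ((IsSeparable.univ_pi fun _ : I => hS).prod (.of_separableSpace univ)).mono <|
    image_subset_iff.2 fun _ hx => ⟨fun i _ => hx i i.2, mem_univ _⟩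

end NormType

section Reflection

/-- `S` is reflected in `S'` if any finite tuple, some of whose entries belong to `S`, has the same
metric type over these entries, up to arbitrarily small errors, as a tuple in `S'`. -/
def IsReflectedIn {Y : Type*} [SeminormedAddCommGroup Y] [NormedSpace ℝ Y] (S S' : Set Y) : Prop :=
  ∀ (n : ℕ) (I : Set (Fin n)),
    MapsTo (normType I) (I.pi fun _ => S) (closure (normType I '' univ.pi fun _ => S'))

variable {Y : Type*} [SeminormedAddCommGroup Y] [NormedSpace ℝ Y] {S S' : Set Y}

namespace IsReflectedIn

theorem exists_eqOn_dist_combinationNorm_lt (h : IsReflectedIn S S') (hS : S ⊆ S') {n : ℕ}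
    {I : Set (Fin n)} {x : Fin n → Y} (hx : ∀ i ∈ I, x i ∈ S) {δ : ℝ} (hδ : 0 < δ) :
    ∃ y : Fin n → Y, (∀ i, y i ∈ S') ∧ EqOn y x I ∧
      dist (combinationNorm y) (combinationNorm x) < δ := by
  classical
  obtain ⟨_, ⟨z, hz, rfl⟩, hdist⟩ :=
    Metric.mem_closure_iff.1 (h n I hx) (δ / (n + 1)) (by positivity)
  rw [dist_comm, Prod.dist_eq, max_lt_iff] at hdist
  refine ⟨I.piecewise x z, fun i => ?_, I.piecewise_eqOn x z, ?_⟩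
  · by_cases hi : i ∈ I
    · simpa [hi] using hS (hx i hi)
    · simpa [hi] using hz i trivial
  have hpiecewise : dist (I.piecewise x z) z ≤ dist (I.domRestrict z) (I.domRestrict x) := by
    refine (dist_pi_le_iff dist_nonneg).2 fun i => ?_
    by_cases hi : i ∈ I
    · rw [I.piecewise_eq_of_mem x z hi, dist_comm]
      exact dist_le_pi_dist (I.domRestrict z) (I.domRestrict x) ⟨i, hi⟩
    · simp [hi]
  calc dist (combinationNorm (I.piecewise x z)) (combinationNorm x)
      ≤ dist (combinationNorm (I.piecewise x z)) (combinationNorm z) +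
          dist (combinationNorm z) (combinationNorm x) := dist_triangle _ _ _
    _ ≤ n * dist (I.domRestrict z) (I.domRestrict x) +
          dist (combinationNorm z) (combinationNorm x) := by
      gcongr
      refine (dist_combinationNorm_le _ _).trans ?_
      rw [Fintype.card_fin]
      gcongr
    _ < n * (δ / (n + 1)) + δ / (n + 1) :=
      add_lt_add_of_le_of_lt (by gcongr; exact hdist.1.le) hdist.2
    _ = δ := by field_simp

theorem closure_iUnion {S : ℕ → Set Y} (hmono : Monotone S)
    (h : ∀ n, IsReflectedIn (S n) (S (n + 1))) :
    IsReflectedIn (closure (⋃ n, S n)) (closure (⋃ n, S n)) := by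
  intro m I
  rw [mapsTo_iff_image_subset, ← closure_pi_set,
    ← iUnion_pi_of_monotone I.toFinite fun _ _ => hmono]
  refine (image_closure_subset_closure_image (continuous_normType I)).trans
    (closure_minimal ?_ isClosed_closure)
  rw [image_iUnion, iUnion_subset_iff]
  exact fun n => (h n m I).image_subset.trans <| closure_mono <| image_mono <|
    pi_mono fun _ _ => (subset_iUnion S (n + 1)).trans subset_closure

end IsReflectedIn

theorem exists_isSeparable_isReflectedIn {W : Submodule ℝ Y} (hW : IsSeparable (W : Set Y)) :
    ∃ W' : Submodule ℝ Y, IsSeparable (W' : Set Y) ∧ W ≤ W' ∧ IsReflectedIn (W : Set Y) W' := by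
  choose t _ ht hdense using fun (n : ℕ) (I : Set (Fin n)) =>
    exists_countable_subset_image_subset_closure (isSeparable_normType_image (I := I) hW)
  let D : Set Y := ⋃ (n) (I : Set (Fin n)), ⋃ x ∈ t n I, range x
  have hD : D.Countable := countable_iUnion fun n => countable_iUnion fun I =>
    (ht n I).biUnion fun x _ => countable_range x
  refine ⟨Submodule.span ℝ (W ∪ D), (hW.union hD.isSeparable).span,
    fun x hx => Submodule.subset_span (Or.inl hx), fun n I => ?_⟩
  refine mapsTo_iff_image_subset.2 ((hdense n I).trans (closure_mono (image_mono ?_)))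
  refine fun x hx i _ => Submodule.subset_span (Or.inr ?_)
  simp only [D, mem_iUnion]
  exact ⟨n, I, x, hx, mem_range_self i⟩

theorem exists_isClosed_isSeparable_isReflectedIn_self (hS : IsSeparable S) :
    ∃ X : Submodule ℝ Y, IsClosed (X : Set Y) ∧ IsSeparable (X : Set Y) ∧ S ⊆ X ∧
      IsReflectedIn (X : Set Y) X := by
  choose next hsep hle hrefl using
    fun W : {W : Submodule ℝ Y // IsSeparable (W : Set Y)} => exists_isSeparable_isReflectedIn W.2
  let chain (n : ℕ) : {W : Submodule ℝ Y // IsSeparable (W : Set Y)} :=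
    (fun W => ⟨next W, hsep W⟩)^[n] ⟨Submodule.span ℝ S, hS.span⟩
  have chain_succ (n : ℕ) : (chain (n + 1)).1 = next (chain n) := by
    simp only [chain, Function.iterate_succ_apply']
  have hmono : Monotone fun n => (chain n).1 :=
    monotone_nat_of_le_succ fun n => (hle _).trans_eq (chain_succ n).symm
  let X : Submodule ℝ Y := (⨆ n, (chain n).1).topologicalClosure
  have hX : (X : Set Y) = closure (⋃ n, ((chain n).1 : Set Y)) := by
    rw [Submodule.topologicalClosure_coe, Submodule.coe_iSup_of_directed _ hmono.directed_le]
  refine ⟨X, Submodule.isClosed_topologicalClosure _, ?_, ?_, ?_⟩ <;> rw [hX]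
  · exact (IsSeparable.iUnion fun n => (chain n).2).closure
  · exact Submodule.subset_span.trans <|
      (subset_iUnion (fun n => ((chain n).1 : Set Y)) 0).trans subset_closure
  · exact IsReflectedIn.closure_iUnion hmono fun n => chain_succ n ▸ hrefl (chain n)

end Reflection

section SeparableDetermination

variable {Y : Type*} [NormedAddCommGroup Y] [NormedSpace ℝ Y]

theorem IsReflectedIn.isAlmostIsometricIdeal {X : Submodule ℝ Y}
    (hX : IsReflectedIn (X : Set Y) X) : IsAlmostIsometricIdeal X := by
  intro ε hε E _
  obtain ⟨n, b, I, hI⟩ := exists_basis_span_image_eq (X.comap E.subtype)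
  let coord : E →L[ℝ] Fin n → ℝ := b.equivFun.toLinearMap.toContinuousLinearMap
  have hbX (i) (hi : i ∈ I) : (b i : Y) ∈ X := by
    have : b i ∈ X.comap E.subtype := hI ▸ Submodule.subset_span (mem_image_of_mem b hi)
    exact this
  obtain ⟨y, hyX, hyb, hdist⟩ := hX.exists_eqOn_dist_combinationNorm_lt Subset.rfl hbX
    (δ := ε / (‖coord‖ + 1)) (by positivity)
  let T : E →ₗ[ℝ] X := b.constr ℝ fun i => ⟨y i, hyX i⟩
  have hTsum (e : E) : (T e : Y) = ∑ i, coord e i • y i := by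
    simp [T, coord, Basis.constr_apply_fintype]
  have hsum (e : E) : (e : Y) = ∑ i, coord e i • (b i : Y) := by
    calc (e : Y) = E.subtype (∑ i, b.equivFun e i • b i) := by rw [b.sum_equivFun]; rfl
      _ = ∑ i, coord e i • (b i : Y) := by simp only [map_sum, map_smul]; rfl
  have hfix : EqOn (X.subtype ∘ₗ T) E.subtype (b '' I) := by
    rintro _ ⟨i, hi, rfl⟩
    simpa [T] using hyb hi
  have hnorm (e : E) : |‖T e‖ - ‖e‖| ≤ ε * ‖e‖ := by
    calc |‖T e‖ - ‖e‖| = |‖∑ i, coord e i • y i‖ - ‖∑ i, coord e i • (b i : Y)‖| := by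
          rw [← hTsum, ← hsum]; rfl
      _ ≤ ε / (‖coord‖ + 1) * (‖coord‖ * ‖e‖) := (abs_norm_sum_smul_sub_le _ _ _).trans
          (mul_le_mul hdist.le (coord.le_opNorm e) (norm_nonneg _) (by positivity))
      _ = ε * ‖e‖ * (‖coord‖ / (‖coord‖ + 1)) := by ring
      _ ≤ ε * ‖e‖ := mul_le_of_le_one_right (by positivity)
          ((div_le_one (by positivity)).2 (by linarith))
  refine ⟨T, fun e he => LinearMap.eqOn_span hfix (hI ▸ he), fun e => ?_⟩
  constructor <;> linarith [abs_le.1 (hnorm e)]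

theorem DaugavetProperty.of_forall_separable
    (h : ∀ X : Submodule ℝ Y, IsClosed (X : Set Y) → SeparableSpace X →
      IsAlmostIsometricIdeal X → DaugavetProperty X) : DaugavetProperty Y := by
  refine daugavetProperty_iff_smulRight.2 fun φ hφ y hy => ?_
  obtain ⟨s, hs, hnorming⟩ := exists_countable_forall_norm_comp_subtypeL_eq φ
  obtain ⟨X, hclosed, hsep, hsub, hX⟩ :=
    exists_isClosed_isSeparable_isReflectedIn_self (hs.insert y).isSeparable
  obtain ⟨hyX, hsX⟩ := insert_subset_iff.1 hsub
  have hnorm := hnorming X hsX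
  let x : X := ⟨y, hyX⟩
  have hDaugavet : DaugavetProperty X := h X hclosed hsep.separableSpace hX.isAlmostIsometricIdeal
  calc 1 + ‖φ‖ * ‖y‖ = 1 + ‖φ.comp X.subtypeL‖ * ‖x‖ := by rw [hnorm]; rfl
    _ ≤ ‖ContinuousLinearMap.id ℝ X + (φ.comp X.subtypeL).smulRight x‖ :=
      daugavetProperty_iff_smulRight.1 hDaugavet _
        (norm_ne_zero_iff.1 (hnorm ▸ norm_ne_zero_iff.2 hφ)) x
        fun hx => hy (congrArg Subtype.val hx)
    _ ≤ ‖ContinuousLinearMap.id ℝ Y + φ.smulRight y‖ := norm_id_add_smulRight_restrict_le φ x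

end SeparableDetermination

theorem mainTheorem3_general (Y : Type*) [NormedAddCommGroup Y] [NormedSpace ℝ Y] :
    DaugavetProperty Y ↔
      ∀ X : Submodule ℝ Y, IsClosed (X : Set Y) → SeparableSpace X →
        IsAlmostIsometricIdeal X → DaugavetProperty X :=
  ⟨fun hY _ _ _ hX => hY.of_isAlmostIsometricIdeal hX, .of_forall_separable⟩

theorem mainTheorem3 (Y : Type*) [NormedAddCommGroup Y] [NormedSpace ℝ Y] [CompleteSpace Y] :
    DaugavetProperty Y ↔
      ∀ X : Submodule ℝ Y, IsClosed (X : Set Y) → TopologicalSpace.SeparableSpace X →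
        IsAlmostIsometricIdeal X → DaugavetProperty X :=
  mainTheorem3_general Y
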